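/- Let $\mathcal M\subset\mathbb R^d$ be a closed (compact, without boundary), connected, $k$-dimensional $C^\infty$ submanifold, and let $\mathcal D\subset\mathcal M$ be a smooth submanifold of $\mathbb R^d$ with (possibly empty) smooth boundary. Let $R,K\in C^2([0,\infty))$ be nonnegative kernels such that $R(r)=0$ for $r>1$, $K(r)=0$ for $r>r_0$ with some $r_0\ge 2$, and, for some $\delta_0>0$, $R\ge\delta_0$ on $[0,1/2]$ and $K\ge\delta_0$ on $[0,2]$. For $\delta>0$ put $$R_\delta(x,y)=C_\delta R\Big(\frac{|x-y|^2}{4\delta^2}\Big),\qquad K_\delta(x,y)=C_\delta K\Big(\frac{|x-y|^2}{4\delta^2}\Big),\qquad C_\delta=\frac1{(4\pi\delta^2)^{k/2}}.$$ Let $P$ consist of $n\ge1$ independent points uniformly distributed on $\mathcal M$ and $S$ of $m\ge1$ independent points uniformly distributed on $\mathcal D$ (the joint law of $P$ and $S$ is arbitrary). For $\mu>0$ let $$L_{\delta,n}u(x)=\sum_{y\in P}R_\delta(x,y)\,(u(x)-u(y))+\mu\sum_{y\in S}K_\delta(x,y)\,u(x),\qquad x\in P.$$ Two points $x,y\in P$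 are neighbours if $R_\delta(x,y)>0$; $x\in S$ and $y\in P\cup S$ are neighbours (in either order) if $K_\delta(x,y)>0$. $P$ is called $S$-connected if every point of $P$ is joined to some point of $S$ by a finite chain of neighbours in $P\cup S$. Then there is a constant $C>0$ depending only on $\mathcal M,\mathcal D,R,K$ such that for all $0<\delta\le1$, all $m\ge 1$ and all $n\ge1$ large enough that $$\frac{C}{\delta^k\sqrt n}\,\big(\ln n-2\ln\delta+1\big)^{1/2}\le 1,$$ with probability at least $1-1/(2n)$ the following holds: $P$ is $S$-connected, and for every $\mu>0$ the operator $L_{\delta,n}$ satisfies the comparison principle: for all real functions $u,v$, $$|L_{\delta,n}u(x)|\le L_{\delta,n}v(x)\ \text{ for all }x\in P\quad\Longrightarrow\quad |u(x)|\le v(x)\ \text{ for all }x\in P.$$ -/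

import Mathlib

open MeasureTheory ProbabilityTheory

noncomputable section

namespace WNLL

open scoped ContDiff

/-- The Euclidean space `ℝᵈ`. -/
abbrev Euc (d : ℕ) : Type := EuclideanSpace ℝ (Fin d)

/-- The closed half-space `{y | 0 ≤ y₀}` of `ℝᵏ` (all of `ℝ⁰` when `k = 0`). -/
def halfSpace (k : ℕ) : Set (Euc k) :=
  {y | ∀ i : Fin k, i.val = 0 → 0 ≤ y i}

/-- Around each of its points, `N ⊆ ℝᵈ` is the image of a relatively open piece `U ∩ H` of the model
set `H ⊆ ℝᵏ` under a smooth immersion `Φ` (defined on the open set `U`) whose restriction to `U ∩ H`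
is a homeomorphism onto a relatively open subset `N ∩ V` of `N`. -/
def IsLocallyParametrized {k d : ℕ} (H : Set (Euc k)) (N : Set (Euc d)) : Prop :=
  ∀ x ∈ N, ∃ (U : Set (Euc k)) (V : Set (Euc d)) (Φ : Euc k → Euc d),
    IsOpen U ∧ IsOpen V ∧ x ∈ V ∧
    ContDiffOn ℝ ∞ Φ U ∧
    (∀ θ ∈ U, Function.Injective (fderiv ℝ Φ θ)) ∧
    Topology.IsEmbedding ((U ∩ H).domRestrict Φ) ∧
    Φ '' (U ∩ H) = N ∩ V

/-- `N` is a `k`-dimensional embedded `C^∞` submanifold (without boundary) of `ℝᵈ`. -/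
def IsSmoothSubmanifold (k : ℕ) {d : ℕ} (N : Set (Euc d)) : Prop :=
  IsLocallyParametrized (Set.univ : Set (Euc k)) N

/-- `N` is a `k`-dimensional embedded `C^∞` submanifold of `ℝᵈ` with (possibly empty, smooth)
boundary. -/
def IsSmoothSubmanifoldWithBoundary (k : ℕ) {d : ℕ} (N : Set (Euc d)) : Prop :=
  IsLocallyParametrized (halfSpace k) N

/-- The assumptions on the two kernel functions. -/
structure KernelAssumptions (R K : ℝ → ℝ) : Prop where
  smooth_R : ContDiffOn ℝ 2 R (Set.Ici 0)
  smooth_K : ContDiffOn ℝ 2 K (Set.Ici 0)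
  nonneg_R : ∀ r, 0 ≤ r → 0 ≤ R r
  nonneg_K : ∀ r, 0 ≤ r → 0 ≤ K r
  support_R : ∀ r, 1 < r → R r = 0
  support_K : ∃ r₀ : ℝ, 2 ≤ r₀ ∧ ∀ r, r₀ < r → K r = 0
  nondegenerate : ∃ δ₀ : ℝ, 0 < δ₀ ∧ (∀ r, 0 ≤ r → r ≤ 1 / 2 → δ₀ ≤ R r) ∧
    (∀ r, 0 ≤ r → r ≤ 2 → δ₀ ≤ K r)

/-- `F_δ(x, y) = C_δ F(|x - y|² / (4 δ²))` with `C_δ = (4 π δ²)^(-k/2)`. -/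
def scaledKernel (k : ℕ) {d : ℕ} (F : ℝ → ℝ) (δ : ℝ) (x y : Euc d) : ℝ :=
  1 / (4 * Real.pi * δ ^ 2) ^ ((k : ℝ) / 2) * F (‖x - y‖ ^ 2 / (4 * δ ^ 2))

/-- The discrete operator
`L u(x) = ∑_{y ∈ P} R_δ(x, y) (u(x) - u(y)) + μ ∑_{y ∈ S} K_δ(x, y) u(x)`. -/
def discreteOp (k : ℕ) {d n m : ℕ} (R K : ℝ → ℝ) (δ μ : ℝ) (P : Fin n → Euc d)
    (S : Fin m → Euc d) (u : Euc d → ℝ) (x : Euc d) : ℝ :=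
  ∑ i, scaledKernel k R δ x (P i) * (u x - u (P i)) +
    μ * ∑ j, scaledKernel k K δ x (S j) * u x

/-- `|L u| ≤ L v` on `P` implies `|u| ≤ v` on `P`. -/
def ComparisonPrinciple (k : ℕ) {d n m : ℕ} (R K : ℝ → ℝ) (δ μ : ℝ) (P : Fin n → Euc d)
    (S : Fin m → Euc d) : Prop :=
  ∀ u v : Euc d → ℝ,
    (∀ x ∈ Set.range P,
      |discreteOp k R K δ μ P S u x| ≤ discreteOp k R K δ μ P S v x) →
    ∀ x ∈ Set.range P, |u x| ≤ v x

/-- The neighbour relation `x ∼ y` on `P ∪ S`: two points of `P` are neighbours when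
`R_δ(x, y) > 0`, and a point of `S` and a point of `P ∪ S` (in either order) when
`K_δ(x, y) > 0`. -/
def Neighbor (k : ℕ) {d : ℕ} (R K : ℝ → ℝ) (δ : ℝ) (P S : Set (Euc d)) (x y : Euc d) : Prop :=
  (x ∈ P ∧ y ∈ P ∧ 0 < scaledKernel k R δ x y) ∨
  (x ∈ S ∧ y ∈ P ∪ S ∧ 0 < scaledKernel k K δ x y) ∨
  (y ∈ S ∧ x ∈ P ∪ S ∧ 0 < scaledKernel k K δ y x)

/-- `P` is `S`-connected: every point of `P` is joined to some point of `S` by a finite chain of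
neighbours in `P ∪ S`. -/
def SConnected (k : ℕ) {d : ℕ} (R K : ℝ → ℝ) (δ : ℝ) (P S : Set (Euc d)) : Prop :=
  ∀ x ∈ P, ∃ y ∈ S, Relation.TransGen (Neighbor k R K δ P S) x y

/-- `X₁, …, Xₙ` are independent and uniformly distributed on the `k`-dimensional set `N`. The
`k`-dimensional volume on a submanifold is, up to a constant factor which cancels after
normalization, the `k`-dimensional Hausdorff measure. -/
structure IsUniformSample {Ω : Type*} [MeasurableSpace Ω] (Pr : Measure Ω) (k : ℕ) {d n : ℕ}
    (N : Set (Euc d)) (X : Fin n → Ω → Euc d) : Prop where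
  measurable : ∀ i, Measurable (X i)
  indep : iIndepFun X Pr
  law : ∀ i, Measure.map (X i) Pr = cond (Measure.hausdorffMeasure (k : ℝ)) N

end WNLL

end

/-! The comparison principle is a discrete maximum principle applied to `v + u` and `v - u`. At a
negative minimum every term of the operator is nonpositive, so each vanishes: the minimal value
spreads along neighbours, and a chain to `S` forces a nonzero `K`-term
(`WNLL.nonneg_of_discreteOp_nonneg`). So only `S`-connectedness is random. Balls of radius `r ≤ 1`
about points of the compact `M` have volume at least a constant times `r ^ k`. Hence a maximal
separated set at scale `δ` has `O(δ ^ (-k))` points, and a union bound shows that `P` meets the ball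
about each of them except with probability at most `1 / (2 * n)`. Then `P` is `δ / 4`-dense in `M`,
and connectedness of `M` yields the chains. A single point of `S` in `M` suffices, so the joint law
of `P` and `S` plays no role. -/

/-! ### Volume of small balls in a compact submanifold. -/

open Metric Topology in
theorem WNLL.exists_bilipschitz_ball {k d : ℕ} {U : Set (WNLL.Euc k)} {Φ : WNLL.Euc k → WNLL.Euc d}
    (hU : IsOpen U) (hΦ : ContDiffOn ℝ (⊤ : ℕ∞) Φ U) {θ : WNLL.Euc k} (hθ : θ ∈ U)
    (hinj : Function.Injective (fderiv ℝ Φ θ)) :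
    ∃ ρ > 0, ∃ L > 0, ∃ K > 0, ball θ ρ ⊆ U ∧ ∀ a ∈ ball θ ρ, ∀ b ∈ ball θ ρ,
      dist (Φ a) (Φ b) ≤ L * dist a b ∧ dist a b ≤ K * dist (Φ a) (Φ b) := by
  set f' := fderiv ℝ Φ θ with hf'
  have hs : HasStrictFDerivAt Φ f' θ :=
    (hΦ.contDiffAt (hU.mem_nhds hθ)).hasStrictFDerivAt (by simp)
  obtain ⟨K, hK, hanti⟩ := (f' : WNLL.Euc k →ₗ[ℝ] WNLL.Euc d).exists_antilipschitzWith
    (LinearMap.ker_eq_bot.2 hinj)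
  have hK' : (0 : ℝ) < K := hK
  -- The linear part expands by at least `1 / K`; an error of half that size can be absorbed.
  have hlo := (hs.isLittleO.def (c := 1 / (2 * K)) (by positivity))
  have hev := Filter.Eventually.and hlo (prod_mem_nhds (hU.mem_nhds hθ) (hU.mem_nhds hθ))
  obtain ⟨ρ, hρ, hball⟩ := Metric.eventually_nhds_iff_ball.1 hev
  have key : ∀ a ∈ ball θ ρ, ∀ b ∈ ball θ ρ,
      ‖Φ a - Φ b - f' (a - b)‖ ≤ 1 / (2 * K) * ‖a - b‖ := by
    intro a ha b hb
    have hab : (a, b) ∈ ball (θ, θ) ρ := by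
      rw [← ball_prod_same]; exact ⟨ha, hb⟩
    exact (hball _ hab).1
  refine ⟨ρ, hρ, ‖f'‖ + 1 / (2 * K), by positivity, 2 * K, by positivity, ?_, ?_⟩
  · intro a ha
    have hab : (a, a) ∈ ball (θ, θ) ρ := by
      rw [← ball_prod_same]; exact ⟨ha, ha⟩
    exact (hball _ hab).2.1
  · intro a ha b hb
    have h := key a ha b hb
    rw [dist_eq_norm, dist_eq_norm]
    constructor
    · have h1 : ‖Φ a - Φ b‖ ≤ ‖Φ a - Φ b - f' (a - b)‖ + ‖f' (a - b)‖ := by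
        simpa using norm_add_le (Φ a - Φ b - f' (a - b)) (f' (a - b))
      have h2 := f'.le_opNorm (a - b)
      linarith
    · have h1 : ‖f' (a - b)‖ ≤ ‖Φ a - Φ b - f' (a - b)‖ + ‖Φ a - Φ b‖ := by
        rw [norm_sub_rev (Φ a - Φ b)]
        simpa using norm_add_le (f' (a - b) - (Φ a - Φ b)) (Φ a - Φ b)
      have h2 : ‖a - b‖ ≤ K * ‖f' (a - b)‖ := by
        simpa [dist_eq_norm] using hanti.le_mul_dist (a - b) 0
      have h3 : (K : ℝ) * ‖f' (a - b)‖ ≤ K * (1 / (2 * K) * ‖a - b‖ + ‖Φ a - Φ b‖) := by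
        gcongr; linarith
      have h4 : (K : ℝ) * (1 / (2 * K) * ‖a - b‖ + ‖Φ a - Φ b‖)
          = ‖a - b‖ / 2 + K * ‖Φ a - Φ b‖ := by
        field_simp
      linarith

theorem WNLL.hausdorffMeasure_le_image {X Y : Type*} [MetricSpace X] [MetricSpace Y]
    [MeasurableSpace X] [BorelSpace X] [MeasurableSpace Y] [BorelSpace Y]
    {f : X → Y} {s A : Set X} {K : ℝ} (hK : 0 ≤ K)
    (h : ∀ a ∈ s, ∀ b ∈ s, dist a b ≤ K * dist (f a) (f b)) (hA : A ⊆ s) (k : ℕ) :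
    Measure.hausdorffMeasure (k : ℝ) A
      ≤ ENNReal.ofReal (K ^ k) * Measure.hausdorffMeasure (k : ℝ) (f '' A) := by
  have hanti : AntilipschitzWith K.toNNReal (fun a : s => f a) := by
    refine AntilipschitzWith.of_le_mul_dist fun a b => ?_
    rw [Real.coe_toNNReal _ hK]
    exact h a a.2 b b.2
  have h1 := hanti.le_hausdorffMeasure_image (d := (k : ℝ)) (by positivity)
    (Subtype.val ⁻¹' A : Set s)
  have h2 := (isometry_subtype_coe (s := s)).hausdorffMeasure_image (d := (k : ℝ))
    (Or.inl (by positivity)) (Subtype.val ⁻¹' A)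
  rw [Subtype.image_preimage_coe, Set.inter_eq_right.2 hA] at h2
  rw [h2]
  refine h1.trans ?_
  rw [ENNReal.rpow_natCast, ENNReal.ofReal_pow hK, ENNReal.ofReal]
  gcongr
  rintro _ ⟨a, ha, rfl⟩
  exact ⟨a, ha, rfl⟩

-- A bilipschitz chart maps a Euclidean ball of radius comparable to `r` into `M ∩ ball y r`, and
-- its inverse inflates Hausdorff measure by at most `K ^ k`.
open Metric Topology in
theorem WNLL.IsSmoothSubmanifold.exists_hausdorffMeasure_ball_ge_nhds {k d : ℕ} {M : Set (WNLL.Euc d)}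
    (hM : WNLL.IsSmoothSubmanifold k M) {x : WNLL.Euc d} (hx : x ∈ M) :
    ∃ W ∈ 𝓝 x, ∃ c : ℝ, 0 < c ∧ ∀ y ∈ M ∩ W, ∀ r : ℝ, 0 < r → r ≤ 1 →
      ENNReal.ofReal (c * r ^ k) ≤ Measure.hausdorffMeasure (k : ℝ) (M ∩ ball y r) := by
  obtain ⟨U, V, Φ, hU, hV, hxV, hΦ, hinj, hemb, himg⟩ := hM x hx
  rw [Set.inter_univ] at hemb himg
  obtain ⟨θ, hθ, rfl⟩ : x ∈ Φ '' U := himg ▸ ⟨hx, hxV⟩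
  obtain ⟨ρ, hρ, L, hL, K, hK, hsub, hlip⟩ := exists_bilipschitz_ball hU hΦ hθ (hinj θ hθ)
  -- the image of a small ball is a neighbourhood in `M`
  have hopen : IsOpen ((Subtype.val : U → Euc k) ⁻¹' ball θ (ρ / 2)) :=
    isOpen_ball.preimage continuous_subtype_val
  obtain ⟨W, hW, hWeq⟩ := hemb.isOpen_iff.1 hopen
  have hmem : ∀ η (hη : η ∈ U), Φ η ∈ W ↔ η ∈ ball θ (ρ / 2) := fun η hη => by
    simpa only [Set.mem_preimage, Set.domRestrict_apply] using Set.ext_iff.1 hWeq ⟨η, hη⟩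
  have hθW : Φ θ ∈ W := (hmem θ hθ).2 (mem_ball_self (half_pos hρ))
  set v := Measure.hausdorffMeasure (k : ℝ) (ball (0 : Euc k) 1) with hv
  have : (Measure.hausdorffMeasure (k : ℝ) : Measure (Euc k)).IsAddHaarMeasure := by
    simpa using isAddHaarMeasure_hausdorffMeasure (E := Euc k)
  have hv0 : 0 < v := measure_ball_pos _ _ one_pos
  have hvtop : v ≠ ⊤ := measure_ball_lt_top.ne
  -- The term `2 / ρ` keeps `ball η (r / L')` inside the chart for `r ≤ 1`, and makes `L < L'`
  -- strict.
  set L' := L + 2 / ρ with hL'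
  have hL'pos : 0 < L' := by positivity
  refine ⟨W ∩ V, (hW.inter hV).mem_nhds ⟨hθW, hxV⟩, v.toReal / (K * L') ^ k,
    div_pos (ENNReal.toReal_pos hv0.ne' hvtop) (by positivity), ?_⟩
  rintro y ⟨hyM, hyW, hyV⟩ r hr hr1
  obtain ⟨η, hη, rfl⟩ : y ∈ Φ '' U := himg ▸ ⟨hyM, hyV⟩
  have hηball : η ∈ ball θ (ρ / 2) := (hmem η hη).1 hyW
  have hrL : r / L' ≤ ρ / 2 := by
    rw [div_le_iff₀ hL'pos, hL']
    have : ρ / 2 * (L + 2 / ρ) = ρ / 2 * L + 1 := by field_simp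
    have : 0 < ρ / 2 * L := by positivity
    linarith
  have hA : ball η (r / L') ⊆ ball θ ρ := by
    refine ball_subset_ball' ?_
    rw [mem_ball] at hηball
    linarith
  have h1 := hausdorffMeasure_le_image hK.le (fun a ha b hb => (hlip a ha b hb).2) hA k
  have hη' : η ∈ ball η (r / L') := mem_ball_self (by positivity)
  have himage : Φ '' ball η (r / L') ⊆ M ∩ ball (Φ η) r := by
    rintro _ ⟨a, ha, rfl⟩
    refine ⟨(himg.subset ⟨a, hsub (hA ha), rfl⟩).1, ?_⟩
    rw [mem_ball] at ha ⊢
    calc dist (Φ a) (Φ η) ≤ L * dist a η := (hlip a (hA ha) η (hA hη')).1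
      _ ≤ L * (r / L') := by gcongr
      _ < L' * (r / L') := by
        have : L < L' := by rw [hL']; linarith [div_pos two_pos hρ]
        gcongr
      _ = r := by field_simp
  rw [Measure.addHaar_ball_of_pos _ _ (by positivity), finrank_euclideanSpace_fin, ← hv] at h1
  have h2 := h1.trans (mul_le_mul_right (measure_mono himage) _)
  have hKk : 0 < K ^ k := by positivity
  have h3 : ENNReal.ofReal (K ^ k) * ENNReal.ofReal (v.toReal / (K * L') ^ k * r ^ k)
      = ENNReal.ofReal ((r / L') ^ k) * v := by
    rw [← ENNReal.ofReal_mul hKk.le]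
    conv_rhs => rw [← ENNReal.ofReal_toReal hvtop]
    rw [← ENNReal.ofReal_mul (by positivity)]
    congr 1
    rw [mul_pow, div_pow]
    field_simp
  rw [← h3] at h2
  exact (ENNReal.mul_le_mul_iff_right (by simpa using hKk) ENNReal.ofReal_ne_top).1 h2

open Metric in
theorem WNLL.IsSmoothSubmanifold.exists_hausdorffMeasure_ball_ge {k d : ℕ} {M : Set (WNLL.Euc d)}
    (hM : WNLL.IsSmoothSubmanifold k M) (hc : IsCompact M) :
    ∃ c : ℝ, 0 < c ∧ ∀ y ∈ M, ∀ r : ℝ, 0 < r → r ≤ 1 →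
      ENNReal.ofReal (c * r ^ k) ≤ Measure.hausdorffMeasure (k : ℝ) (M ∩ ball y r) := by
  suffices ∃ c : ℝ, 0 < c ∧ ∀ y ∈ M ∩ M, ∀ r : ℝ, 0 < r → r ≤ 1 →
      ENNReal.ofReal (c * r ^ k) ≤ Measure.hausdorffMeasure (k : ℝ) (M ∩ ball y r) by
    simpa using this
  refine hc.induction_on (p := fun s => ∃ c : ℝ, 0 < c ∧ ∀ y ∈ M ∩ s, ∀ r : ℝ, 0 < r → r ≤ 1 →
      ENNReal.ofReal (c * r ^ k) ≤ Measure.hausdorffMeasure (k : ℝ) (M ∩ ball y r)) ?_ ?_ ?_ ?_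
  · exact ⟨1, one_pos, by simp⟩
  · rintro s t hst ⟨c, hc, h⟩
    exact ⟨c, hc, fun y hy => h y ⟨hy.1, hst hy.2⟩⟩
  · rintro s t ⟨c, hc, h⟩ ⟨c', hc', h'⟩
    refine ⟨min c c', lt_min hc hc', ?_⟩
    rintro y ⟨hyM, hy | hy⟩ r hr hr1
    · refine le_trans (ENNReal.ofReal_le_ofReal ?_) (h y ⟨hyM, hy⟩ r hr hr1)
      gcongr; exact min_le_left _ _
    · refine le_trans (ENNReal.ofReal_le_ofReal ?_) (h' y ⟨hyM, hy⟩ r hr hr1)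
      gcongr; exact min_le_right _ _
  · intro x hx
    obtain ⟨W, hW, c, hc, h⟩ := hM.exists_hausdorffMeasure_ball_ge_nhds hx
    exact ⟨W, mem_nhdsWithin_of_mem_nhds hW, c, hc, h⟩

/-! ### The discrete maximum principle. -/

theorem WNLL.scaledKernel_nonneg (k : ℕ) {d : ℕ} {F : ℝ → ℝ} (hF : ∀ r, 0 ≤ r → 0 ≤ F r)
    (δ : ℝ) (x y : WNLL.Euc d) : 0 ≤ WNLL.scaledKernel k F δ x y :=
  mul_nonneg (by positivity) (hF _ (by positivity))

theorem WNLL.scaledKernel_comm (k : ℕ) {d : ℕ} (F : ℝ → ℝ) (δ : ℝ) (x y : WNLL.Euc d) :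
    WNLL.scaledKernel k F δ x y = WNLL.scaledKernel k F δ y x := by
  rw [scaledKernel, scaledKernel, norm_sub_rev]

theorem WNLL.scaledKernel_pos (k : ℕ) {d : ℕ} {F : ℝ → ℝ} {δ δ₀ a : ℝ} (hδ : 0 < δ) (hδ₀ : 0 < δ₀)
    (hF : ∀ r, 0 ≤ r → r ≤ a → δ₀ ≤ F r) (ha : 1 / 2 ≤ a) {x y : WNLL.Euc d} (h : dist x y ≤ δ) :
    0 < WNLL.scaledKernel k F δ x y := by
  have hxy : ‖x - y‖ ^ 2 / (4 * δ ^ 2) ≤ a := by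
    rw [div_le_iff₀ (by positivity)]
    rw [dist_eq_norm] at h
    have h1 : ‖x - y‖ ^ 2 ≤ δ ^ 2 := by gcongr
    nlinarith [sq_nonneg δ]
  exact mul_pos (by positivity) (hδ₀.trans_le (hF _ (by positivity) hxy))

theorem WNLL.discreteOp_add (k : ℕ) {d n m : ℕ} (R K : ℝ → ℝ) (δ μ : ℝ) (P : Fin n → WNLL.Euc d)
    (S : Fin m → WNLL.Euc d) (u v : WNLL.Euc d → ℝ) (x : WNLL.Euc d) :
    WNLL.discreteOp k R K δ μ P S (u + v) x
      = WNLL.discreteOp k R K δ μ P S u x + WNLL.discreteOp k R K δ μ P S v x := by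
  have h : ∀ i, scaledKernel k R δ x (P i) * ((u + v) x - (u + v) (P i))
      = scaledKernel k R δ x (P i) * (u x - u (P i))
        + scaledKernel k R δ x (P i) * (v x - v (P i)) := fun i => by
    simp only [Pi.add_apply]; ring
  simp only [discreteOp, h, Finset.sum_add_distrib, ← Finset.sum_mul]
  simp only [Pi.add_apply]
  ring

theorem WNLL.discreteOp_neg (k : ℕ) {d n m : ℕ} (R K : ℝ → ℝ) (δ μ : ℝ) (P : Fin n → WNLL.Euc d)
    (S : Fin m → WNLL.Euc d) (u : WNLL.Euc d → ℝ) (x : WNLL.Euc d) :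
    WNLL.discreteOp k R K δ μ P S (-u) x = -WNLL.discreteOp k R K δ μ P S u x := by
  have h : ∀ i, scaledKernel k R δ x (P i) * ((-u) x - (-u) (P i))
      = -(scaledKernel k R δ x (P i) * (u x - u (P i))) := fun i => by
    simp only [Pi.neg_apply]; ring
  simp only [discreteOp, h, Finset.sum_neg_distrib, ← Finset.sum_mul]
  simp only [Pi.neg_apply]
  ring

/-- At a negative minimum of `w` with `L w ≥ 0`, no point of `S` is near and `w` takes the same
value at all neighbours in `P`. -/
theorem WNLL.eq_of_discreteOp_nonneg_of_min {k d n m : ℕ} {R K : ℝ → ℝ}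
    (hR : ∀ r, 0 ≤ r → 0 ≤ R r) (hK : ∀ r, 0 ≤ r → 0 ≤ K r) {δ μ : ℝ} (hμ : 0 < μ)
    {P : Fin n → WNLL.Euc d} {S : Fin m → WNLL.Euc d} {w : WNLL.Euc d → ℝ} {x : WNLL.Euc d}
    (hw : 0 ≤ WNLL.discreteOp k R K δ μ P S w x) (hmin : ∀ i, w x ≤ w (P i)) (hneg : w x < 0) :
    (∀ j, ¬ 0 < WNLL.scaledKernel k K δ x (S j)) ∧
      ∀ i, 0 < WNLL.scaledKernel k R δ x (P i) → w (P i) = w x := by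
  have h1 : ∀ i ∈ Finset.univ, scaledKernel k R δ x (P i) * (w x - w (P i)) ≤ 0 := fun i _ =>
    mul_nonpos_of_nonneg_of_nonpos (scaledKernel_nonneg k hR δ x _) (by linarith [hmin i])
  have h2 : ∀ j ∈ Finset.univ, scaledKernel k K δ x (S j) * w x ≤ 0 := fun j _ =>
    mul_nonpos_of_nonneg_of_nonpos (scaledKernel_nonneg k hK δ x _) hneg.le
  have s1 := Finset.sum_nonpos h1
  have s2 := Finset.sum_nonpos h2
  rw [discreteOp] at hw
  have s2' : μ * ∑ j, scaledKernel k K δ x (S j) * w x ≤ 0 :=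
    mul_nonpos_of_nonneg_of_nonpos hμ.le s2
  have e1 : ∑ i, scaledKernel k R δ x (P i) * (w x - w (P i)) = 0 := by linarith
  have e2 : ∑ j, scaledKernel k K δ x (S j) * w x = 0 := by
    have : μ * ∑ j, scaledKernel k K δ x (S j) * w x = 0 := by linarith
    exact (mul_eq_zero.1 this).resolve_left hμ.ne'
  rw [Finset.sum_eq_zero_iff_of_nonpos h1] at e1
  rw [Finset.sum_eq_zero_iff_of_nonpos h2] at e2
  refine ⟨fun j hj => ?_, fun i hi => ?_⟩
  · exact (mul_neg_of_pos_of_neg hj hneg).ne (e2 j (Finset.mem_univ j))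
  · have := (mul_eq_zero.1 (e1 i (Finset.mem_univ i))).resolve_left hi.ne'
    linarith

theorem WNLL.nonneg_of_discreteOp_nonneg {k d n m : ℕ} {R K : ℝ → ℝ}
    (hRK : WNLL.KernelAssumptions R K) {δ μ : ℝ} (hδ : 0 < δ) (hμ : 0 < μ)
    {P : Fin n → WNLL.Euc d} {S : Fin m → WNLL.Euc d}
    (hconn : WNLL.SConnected k R K δ (Set.range P) (Set.range S)) {w : WNLL.Euc d → ℝ}
    (hw : ∀ x ∈ Set.range P, 0 ≤ WNLL.discreteOp k R K δ μ P S w x) :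
    ∀ x ∈ Set.range P, 0 ≤ w x := by
  intro x hx
  obtain ⟨i₀, rfl⟩ := hx
  obtain ⟨a, -, ha⟩ := Finset.exists_min_image Finset.univ (fun i => w (P i)) ⟨i₀, Finset.mem_univ _⟩
  by_contra! hneg
  have haneg : w (P a) < 0 := (ha i₀ (Finset.mem_univ _)).trans_lt hneg
  obtain ⟨δ₀, hδ₀, -, hK₀⟩ := hRK.nondegenerate
  have hself : ∀ z : Euc d, 0 < scaledKernel k K δ z z := fun z =>
    scaledKernel_pos k hδ hδ₀ hK₀ (by norm_num) (by simpa using hδ.le)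
  have step : ∀ z ∈ Set.range P, w z = w (P a) → (∀ y ∈ Set.range S, ¬ 0 < scaledKernel k K δ z y) ∧
      ∀ y ∈ Set.range P, 0 < scaledKernel k R δ z y → w y = w (P a) := by
    intro z hz hwz
    have := eq_of_discreteOp_nonneg_of_min hRK.nonneg_R hRK.nonneg_K hμ (hw z hz)
      (fun i => hwz ▸ ha i (Finset.mem_univ _)) (hwz ▸ haneg)
    refine ⟨?_, ?_⟩
    · rintro _ ⟨j, rfl⟩; exact this.1 j
    · rintro _ ⟨i, rfl⟩ h; rw [this.2 i h, hwz]
  -- A minimizer has no neighbour in `S` and is not itself in `S`, since the kernel is positive on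
  -- the diagonal; the chain therefore never leaves `P`.
  have nbr : ∀ z y, z ∈ Set.range P → w z = w (P a) →
      Neighbor k R K δ (Set.range P) (Set.range S) z y → y ∈ Set.range P ∧ w y = w (P a) := by
    rintro z y hz hwz (⟨-, hy, h⟩ | ⟨hzS, -, -⟩ | ⟨hy, -, h⟩)
    · exact ⟨hy, (step z hz hwz).2 y hy h⟩
    · exact absurd (hself z) ((step z hz hwz).1 z hzS)
    · rw [scaledKernel_comm] at h
      exact absurd h ((step z hz hwz).1 y hy)
  obtain ⟨y, hy, hchain⟩ := hconn (P a) ⟨a, rfl⟩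
  have hend : y ∈ Set.range P ∧ w y = w (P a) := by
    clear hy
    induction hchain with
    | single h => exact nbr _ _ ⟨a, rfl⟩ rfl h
    | tail _ h ih => exact nbr _ _ ih.1 ih.2 h
  exact (step y hend.1 hend.2).1 y hy (hself y)

theorem WNLL.comparisonPrinciple_of_sConnected {k d n m : ℕ} {R K : ℝ → ℝ}
    (hRK : WNLL.KernelAssumptions R K) {δ μ : ℝ} (hδ : 0 < δ) (hμ : 0 < μ)
    {P : Fin n → WNLL.Euc d} {S : Fin m → WNLL.Euc d}
    (hconn : WNLL.SConnected k R K δ (Set.range P) (Set.range S)) :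
    WNLL.ComparisonPrinciple k R K δ μ P S := by
  intro u v h x hx
  have h1 := nonneg_of_discreteOp_nonneg hRK hδ hμ hconn (w := v + u) (fun x hx => by
    rw [discreteOp_add]; linarith [(abs_le.1 (h x hx)).1]) x hx
  have h2 := nonneg_of_discreteOp_nonneg hRK hδ hμ hconn (w := v + -u) (fun x hx => by
    rw [discreteOp_add, discreteOp_neg]; linarith [(abs_le.1 (h x hx)).2]) x hx
  simp only [Pi.add_apply, Pi.neg_apply] at h1 h2
  exact abs_le.2 ⟨by linarith, by linarith⟩

/-! ### Connectivity of dense samples, nets and probability bounds. -/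

open Metric in
/-- If a sample `P ⊆ M` of a connected set `M` meets every ball of radius `δ / 4` around points
of `M` and `S` meets `M`, then `P` is `S`-connected. -/
theorem WNLL.sConnected_of_dense {k d : ℕ} {R K : ℝ → ℝ} (hRK : WNLL.KernelAssumptions R K)
    {δ : ℝ} (hδ : 0 < δ) {M P S : Set (WNLL.Euc d)} (hM : IsPreconnected M) (hPM : P ⊆ M)
    (hS : (S ∩ M).Nonempty) (hdense : ∀ y ∈ M, ∃ p ∈ P, dist p y < δ / 4) :
    WNLL.SConnected k R K δ P S := by
  obtain ⟨δ₀, hδ₀, hR₀, hK₀⟩ := hRK.nondegenerate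
  obtain ⟨s, hsS, hsM⟩ := hS
  have near : ∀ p ∈ P, ∀ q ∈ P, dist p q ≤ δ →
      Relation.TransGen (Neighbor k R K δ P S) p q := fun p hp q hq h =>
    .single (Or.inl ⟨hp, hq, scaledKernel_pos k hδ hδ₀ hR₀ le_rfl h⟩)
  have chain : ∀ x ∈ M, ∀ y ∈ M, ∀ p ∈ P, ∀ q ∈ P, dist p x < δ / 4 → dist q y < δ / 4 →
      Relation.TransGen (Neighbor k R K δ P S) p q := by
    intro x hx y hy
    -- Quantifying over all sample points near `x` and `y` makes the relation transitive: density
    -- supplies an intermediate point.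
    refine hM.induction₂' (fun x y => ∀ p ∈ P, ∀ q ∈ P, dist p x < δ / 4 → dist q y < δ / 4 →
      Relation.TransGen (Neighbor k R K δ P S) p q) ?_ ?_ hx hy
    · intro x _
      filter_upwards [mem_nhdsWithin_of_mem_nhds (ball_mem_nhds x (show 0 < δ / 4 by positivity))]
        with y hy
      rw [mem_ball] at hy
      refine ⟨fun p hp q hq hpx hqy => near p hp q hq ?_, fun p hp q hq hpy hqx =>
        near p hp q hq ?_⟩
      · linarith [dist_triangle4 p x y q, dist_comm x y, dist_comm y q]
      · linarith [dist_triangle4 p y x q, dist_comm x q]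
    · intro x y z _ hy _ hxy hyz p hp q hq hpx hqz
      obtain ⟨o, ho, hoy⟩ := hdense y hy
      exact (hxy p hp o ho hpx hoy).trans (hyz o ho q hq hoy hqz)
  intro x hx
  obtain ⟨q, hq, hqs⟩ := hdense s hsM
  refine ⟨s, hsS, (chain x (hPM hx) s hsM x hx q hq (by simpa using hδ) hqs).tail ?_⟩
  refine Or.inr (Or.inr ⟨hsS, Or.inl hq, scaledKernel_pos k hδ hδ₀ hK₀ (by norm_num) ?_⟩)
  rw [dist_comm]; linarith

-- For a maximal `2 * r`-separated `T ⊆ M`, the `r`-balls are disjoint with mass at least `q` each,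
-- which bounds the cardinality; maximality gives the covering.
open Metric in
theorem WNLL.exists_finset_cover_of_measure_ball_ge {X : Type*} [PseudoMetricSpace X] [MeasurableSpace X]
    [OpensMeasurableSpace X] (ν : Measure X) [IsProbabilityMeasure ν] {M : Set X} {q r : ℝ}
    (hq : 0 < q) (h : ∀ y ∈ M, ENNReal.ofReal q ≤ ν (ball y r)) :
    ∃ T : Finset X, (T : Set X) ⊆ M ∧ T.card * q ≤ 1 ∧ ∀ y ∈ M, ∃ t ∈ T, dist t y < 2 * r := by
  classical
  let Sep : Finset X → Prop := fun T => (T : Set X) ⊆ M ∧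
    (T : Set X).Pairwise fun s t => 2 * r ≤ dist s t
  have hcard : ∀ T, Sep T → T.card * q ≤ 1 := by
    rintro T ⟨hTM, hT⟩
    have hdisj : (T : Set X).PairwiseDisjoint fun t => ball t r := fun s hs t ht hst =>
      ball_disjoint_ball (by linarith [hT hs ht hst])
    have h1 : ∑ t ∈ T, ν (ball t r) ≤ 1 := by
      rw [← measure_biUnion_finset hdisj fun _ _ => measurableSet_ball]
      exact prob_le_one
    have h2 : ∑ _t ∈ T, ENNReal.ofReal q ≤ 1 :=
      (Finset.sum_le_sum fun t ht => h t (hTM ht)).trans h1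
    rw [Finset.sum_const, nsmul_eq_mul, ← ENNReal.ofReal_natCast,
      ← ENNReal.ofReal_mul (by positivity), ENNReal.ofReal_le_one] at h2
    exact h2
  have hbdd : ∀ T, Sep T → T.card ≤ ⌊1 / q⌋₊ := fun T hT =>
    Nat.le_floor (by rw [le_div_iff₀ hq]; exact hcard T hT)
  -- Minimizing `⌊1 / q⌋₊ - T.card` maximizes the cardinality; by `hbdd` the natural subtraction
  -- never truncates.
  obtain ⟨T, hT, hmax⟩ := WellFounded.has_min
    (InvImage.wf (fun T : Finset X => ⌊1 / q⌋₊ - T.card) Nat.lt_wfRel.wf) {T | Sep T}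
    ⟨∅, by simp [Sep]⟩
  refine ⟨T, hT.1, hcard T hT, fun y hy => ?_⟩
  by_contra! hfar
  by_cases hr : 0 < r
  swap
  · have := h y hy
    rw [ball_eq_empty.2 (not_lt.1 hr), measure_empty, nonpos_iff_eq_zero,
      ENNReal.ofReal_eq_zero] at this
    exact this.not_gt hq
  have hyT : y ∉ T := fun hyT => by
    have := hfar y hyT
    rw [dist_self] at this
    linarith
  have hins : Sep (insert y T) := by
    refine ⟨?_, ?_⟩
    · rw [Finset.coe_insert]
      exact Set.insert_subset hy hT.1
    · rw [Finset.coe_insert, Set.pairwise_insert]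
      exact ⟨hT.2, fun t ht _ => ⟨dist_comm y t ▸ hfar t ht, hfar t ht⟩⟩
  refine hmax _ hins ?_
  have := hbdd _ hins
  rw [Finset.card_insert_of_notMem hyT] at this
  change ⌊1 / q⌋₊ - (insert y T).card < ⌊1 / q⌋₊ - T.card
  rw [Finset.card_insert_of_notMem hyT]
  omega

/-- The probability that `n` independent points all miss a set of probability at least `q` is at
most `exp (-n q)`. -/
theorem WNLL.measure_forall_notMem_le {Ω X : Type*} [MeasurableSpace Ω] [MeasurableSpace X]
    {Pr : Measure Ω} {n : ℕ} {P : Fin n → Ω → X}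
    (hP : ∀ i, Measurable (P i)) (hind : iIndepFun P Pr) {ν : Measure X} [IsProbabilityMeasure ν]
    (hlaw : ∀ i, Measure.map (P i) Pr = ν) {B : Set X} (hB : MeasurableSet B) {q : ℝ}
    (hq : ENNReal.ofReal q ≤ ν B) :
    Pr {ω | ∀ i, P i ω ∉ B} ≤ ENNReal.ofReal (Real.exp (-(n * q))) := by
  have hset : {ω | ∀ i, P i ω ∉ B} = ⋂ i, P i ⁻¹' Bᶜ := by
    ext ω; simp
  rw [hset, hind.meas_iInter fun i => ⟨Bᶜ, hB.compl, rfl⟩]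
  have hone : ∀ i, Pr (P i ⁻¹' Bᶜ) ≤ ENNReal.ofReal (Real.exp (-q)) := fun i => by
    rw [← Measure.map_apply (hP i) hB.compl, hlaw i, prob_compl_eq_one_sub hB]
    calc 1 - ν B ≤ 1 - ENNReal.ofReal q := tsub_le_tsub_left hq 1
      _ ≤ ENNReal.ofReal (1 - q) := by
        rw [tsub_le_iff_right]
        calc (1 : ENNReal) = ENNReal.ofReal (1 - q + q) := by simp
          _ ≤ _ := ENNReal.ofReal_add_le
      _ ≤ _ := ENNReal.ofReal_le_ofReal (Real.one_sub_le_exp_neg q)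
  refine (Finset.prod_le_prod' fun i _ => hone i).trans_eq ?_
  rw [Finset.prod_const, Finset.card_univ, Fintype.card_fin, ← ENNReal.ofReal_pow (by positivity),
    ← Real.exp_nat_mul, mul_neg]

theorem WNLL.exists_const_exp_le {c : ℝ} (hc : 0 < c) (k : ℕ) :
    ∃ C : ℝ, 0 < C ∧ ∀ δ : ℝ, 0 < δ → δ ≤ 1 → ∀ n : ℕ, 1 ≤ n →
      C / (δ ^ k * Real.sqrt n) * Real.sqrt (Real.log n - 2 * Real.log δ + 1) ≤ 1 →
      1 / (c * δ ^ k) * Real.exp (-(n * (c * δ ^ k))) ≤ 1 / (2 * n) := by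
  -- `C ^ 2 * c` is the factor by which `X ≥ 1` dominates `log (2 * n / (c * δ ^ k))`, that is `log
  -- (2 / c) + log n - k * log δ`.
  refine ⟨Real.sqrt ((1 + k + |Real.log (2 / c)|) / c), by positivity, ?_⟩
  intro δ hδ hδ1 n hn h
  have hn1 : (1 : ℝ) ≤ n := by exact_mod_cast hn
  have hn0 : (0 : ℝ) < n := by linarith
  have hlogn : 0 ≤ Real.log n := Real.log_nonneg hn1
  have hlogδ : Real.log δ ≤ 0 := Real.log_nonpos hδ.le hδ1
  set X := Real.log n - 2 * Real.log δ + 1 with hX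
  have hX0 : 0 ≤ X := by linarith
  have hδk : δ ^ k ≤ 1 := pow_le_one₀ hδ.le hδ1
  have hδk0 : 0 < δ ^ k := by positivity
  have hmain : (1 + k + |Real.log (2 / c)|) * X ≤ n * (c * δ ^ k) := by
    rw [div_mul_eq_mul_div, div_le_one (by positivity)] at h
    have h2 := pow_le_pow_left₀ (by positivity) h 2
    rw [mul_pow, mul_pow, Real.sq_sqrt (by positivity), Real.sq_sqrt hX0,
      Real.sq_sqrt hn0.le, div_mul_eq_mul_div, div_le_iff₀ hc] at h2
    refine h2.trans ?_
    have : (δ ^ k) ^ 2 ≤ δ ^ k := by nlinarith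
    calc (δ ^ k) ^ 2 * n * c ≤ δ ^ k * n * c := by gcongr
      _ = n * (c * δ ^ k) := by ring
  have hlow : Real.log (2 * n / (c * δ ^ k)) ≤ n * (c * δ ^ k) := by
    refine le_trans ?_ hmain
    have e : Real.log (2 * n / (c * δ ^ k)) = Real.log (2 / c) + Real.log n - k * Real.log δ := by
      rw [show 2 * n / (c * δ ^ k) = 2 / c * n / δ ^ k by field_simp,
        Real.log_div (by positivity) (by positivity), Real.log_mul (by positivity) (by positivity),
        Real.log_pow]
    rw [e]
    have h1 : |Real.log (2 / c)| * 1 ≤ |Real.log (2 / c)| * X := by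
      gcongr; linarith
    have h2 : (k : ℝ) * (-Real.log δ) ≤ k * X := by
      gcongr; linarith
    have h3 := le_abs_self (Real.log (2 / c))
    nlinarith
  rw [Real.log_le_iff_le_exp (by positivity)] at hlow
  rw [Real.exp_neg, ← one_div, one_div_mul_one_div, one_div_le_one_div (by positivity) (by positivity)]
  rw [div_le_iff₀ (by positivity)] at hlow
  linarith

/-! ### Uniform samples and the main theorem. -/

/-- `cond` on a set of measure `0` or `⊤` is the zero measure, which cannot be the law of a random
variable. -/
theorem WNLL.IsUniformSample.hausdorffMeasure_ne_zero_ne_top {Ω : Type*} [MeasurableSpace Ω]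
    {Pr : Measure Ω} [IsProbabilityMeasure Pr] {k d n : ℕ} {N : Set (WNLL.Euc d)}
    {X : Fin n → Ω → WNLL.Euc d} (hX : WNLL.IsUniformSample Pr k N X) (i : Fin n) :
    Measure.hausdorffMeasure (k : ℝ) N ≠ 0 ∧ Measure.hausdorffMeasure (k : ℝ) N ≠ ⊤ := by
  have hprob := Measure.isProbabilityMeasure_map (μ := Pr) (hX.measurable i).aemeasurable
  rw [hX.law i] at hprob
  have hne := hprob.ne_zero
  constructor
  · exact fun h => hne (cond_eq_zero.2 (Or.inr h))
  · exact fun h => hne (cond_eq_zero.2 (Or.inl h))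

theorem WNLL.IsUniformSample.ae_mem {Ω : Type*} [MeasurableSpace Ω]
    {Pr : Measure Ω} {k d n : ℕ} {N M : Set (WNLL.Euc d)}
    {X : Fin n → Ω → WNLL.Euc d} (hX : WNLL.IsUniformSample Pr k N X) (hM : MeasurableSet M)
    (hNM : N ⊆ M) (i : Fin n) : Pr {ω | X i ω ∉ M} = 0 := by
  have h : Measure.map (X i) Pr Mᶜ = 0 := by
    rw [hX.law i, ProbabilityTheory.cond, Measure.smul_apply, Measure.restrict_apply hM.compl,
      (Set.disjoint_compl_left_iff_subset.2 hNM).inter_eq, measure_empty, smul_zero]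
  rwa [Measure.map_apply (hX.measurable i) hM.compl] at h

theorem theorem2 {d k l : ℕ} (M D : Set (WNLL.Euc d))
    (hM : WNLL.IsSmoothSubmanifold k M) (hMcompact : IsCompact M) (hMconn : IsConnected M)
    (hD : WNLL.IsSmoothSubmanifoldWithBoundary l D) (hDM : D ⊆ M)
    (R K : ℝ → ℝ) (hRK : WNLL.KernelAssumptions R K) :
    ∃ C : ℝ, 0 < C ∧
      ∀ (δ : ℝ), 0 < δ → δ ≤ 1 →
      ∀ (n m : ℕ), 1 ≤ n → 1 ≤ m →
      C / (δ ^ k * Real.sqrt n) * Real.sqrt (Real.log n - 2 * Real.log δ + 1) ≤ 1 →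
      ∀ (Ω : Type*) [MeasurableSpace Ω] (Pr : Measure Ω) [IsProbabilityMeasure Pr]
        (P : Fin n → Ω → WNLL.Euc d) (S : Fin m → Ω → WNLL.Euc d),
      WNLL.IsUniformSample Pr k M P → WNLL.IsUniformSample Pr l D S →
      ∃ A : Set Ω, MeasurableSet A ∧ ENNReal.ofReal (1 - 1 / (2 * (n : ℝ))) ≤ Pr A ∧
        ∀ ω ∈ A,
          WNLL.SConnected k R K δ (Set.range fun i => P i ω) (Set.range fun j => S j ω) ∧
          ∀ μ : ℝ, 0 < μ →
            WNLL.ComparisonPrinciple k R K δ μ (fun i => P i ω) (fun j => S j ω) := by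
  obtain ⟨c₀, hc₀, hball⟩ := hM.exists_hausdorffMeasure_ball_ge hMcompact
  set vol := (Measure.hausdorffMeasure (k : ℝ) M).toReal with hvol
  have hvol0 : 0 ≤ vol := ENNReal.toReal_nonneg
  -- a lower bound for the normalized measure of balls of radius `δ / 16`
  set c := c₀ / (16 ^ k * (vol + 1)) with hc
  have hcpos : 0 < c := by positivity
  obtain ⟨C, hC, hexp⟩ := WNLL.exists_const_exp_le hcpos k
  refine ⟨C, hC, ?_⟩
  intro δ hδ hδ1 n m hn hm hcond Ω _ Pr _ P S hP hS
  have hMmeas : MeasurableSet M := hMcompact.isClosed.measurableSet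
  set ν := cond (Measure.hausdorffMeasure (k : ℝ)) M with hν
  obtain ⟨hM0, hMtop⟩ := hP.hausdorffMeasure_ne_zero_ne_top ⟨0, hn⟩
  have hνprob : IsProbabilityMeasure ν := cond_isProbabilityMeasure_of_finite hM0 hMtop
  -- Hitting radius `r` plus net radius `2 * r` gives `3 * δ / 16 < δ / 4`.
  set r := δ / 16 with hr
  have hq : 0 < c * δ ^ k := by positivity
  have hνball : ∀ y ∈ M, ENNReal.ofReal (c * δ ^ k) ≤ ν (Metric.ball y r) := by
    intro y hy
    rw [hν, cond_apply hMmeas]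
    have h1 := hball y hy r (by positivity) (by rw [hr]; linarith)
    have h2 : ENNReal.ofReal (1 / (vol + 1)) ≤ (Measure.hausdorffMeasure (k : ℝ) M)⁻¹ := by
      rw [← ENNReal.ofReal_toReal hMtop, ← hvol]
      have hv : 0 < vol := ENNReal.toReal_pos hM0 hMtop
      rw [← ENNReal.ofReal_inv_of_pos hv, ← one_div]
      refine ENNReal.ofReal_le_ofReal ?_
      gcongr; linarith
    refine le_trans (le_of_eq ?_) (mul_le_mul' h2 h1)
    rw [← ENNReal.ofReal_mul (by positivity), hc, hr, div_pow]
    congr 1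
    field_simp
  obtain ⟨T, hTM, hTcard, hTcover⟩ := WNLL.exists_finset_cover_of_measure_ball_ge ν hq hνball
  set A : Set Ω := {ω | (∀ t ∈ T, ∃ i, P i ω ∈ Metric.ball t r) ∧ (∀ i, P i ω ∈ M) ∧
    S ⟨0, hm⟩ ω ∈ M} with hA
  have hAmeas : MeasurableSet A := by
    have hA' : A = (⋂ t ∈ T, ⋃ i, P i ⁻¹' Metric.ball t r) ∩
        ((⋂ i, P i ⁻¹' M) ∩ S ⟨0, hm⟩ ⁻¹' M) := by
      ext ω; simp [hA]
    rw [hA']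
    refine (T.measurableSet_biInter fun t _ => ?_).inter (.inter ?_ (hS.measurable _ hMmeas))
    · exact .iUnion fun i => hP.measurable i measurableSet_ball
    · exact .iInter fun i => hP.measurable i hMmeas
  have hAcompl : Pr Aᶜ ≤ ENNReal.ofReal (1 / (2 * (n : ℝ))) := by
    have hsub : Aᶜ ⊆ (⋃ t ∈ T, {ω | ∀ i, P i ω ∉ Metric.ball t r}) ∪
        ((⋃ i, {ω | P i ω ∉ M}) ∪ {ω | S ⟨0, hm⟩ ω ∉ M}) := by
      intro ω hω
      by_contra hcon
      simp only [Set.mem_union, Set.mem_iUnion, Set.mem_ofPred_eq, not_or, not_exists, not_not,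
        exists_prop] at hcon
      refine hω ⟨fun t ht => ?_, hcon.2.1, hcon.2.2⟩
      by_contra! hno
      exact hcon.1 t ⟨ht, hno⟩
    have hnull : Pr ((⋃ i, {ω | P i ω ∉ M}) ∪ {ω | S ⟨0, hm⟩ ω ∉ M}) = 0 :=
      measure_union_null (measure_iUnion_null fun i => hP.ae_mem hMmeas subset_rfl i)
        (hS.ae_mem hMmeas hDM _)
    calc Pr Aᶜ ≤ Pr (⋃ t ∈ T, {ω | ∀ i, P i ω ∉ Metric.ball t r}) + 0 :=
          (measure_mono hsub).trans ((measure_union_le _ _).trans_eq (by rw [hnull]))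
      _ ≤ ∑ t ∈ T, Pr {ω | ∀ i, P i ω ∉ Metric.ball t r} := by
          rw [add_zero]; exact measure_biUnion_finset_le _ _
      _ ≤ ∑ _t ∈ T, ENNReal.ofReal (Real.exp (-(n * (c * δ ^ k)))) :=
          Finset.sum_le_sum fun t ht => WNLL.measure_forall_notMem_le hP.measurable hP.indep
            hP.law measurableSet_ball (hνball t (hTM ht))
      _ = ENNReal.ofReal (T.card * Real.exp (-(n * (c * δ ^ k)))) := by
          rw [Finset.sum_const, nsmul_eq_mul, ENNReal.ofReal_mul (by positivity),
            ENNReal.ofReal_natCast]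
      _ ≤ ENNReal.ofReal (1 / (2 * (n : ℝ))) := by
          refine ENNReal.ofReal_le_ofReal (le_trans ?_ (hexp δ hδ hδ1 n hn hcond))
          gcongr
          rwa [le_div_iff₀ hq]
  refine ⟨A, hAmeas, ?_, ?_⟩
  · rw [← compl_compl A, prob_compl_eq_one_sub hAmeas.compl,
      ENNReal.ofReal_sub _ (by positivity), ENNReal.ofReal_one]
    exact tsub_le_tsub_left hAcompl 1
  · rintro ω ⟨hhit, hPM, hSM⟩
    have hconn : WNLL.SConnected k R K δ (Set.range fun i => P i ω) (Set.range fun j => S j ω) := by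
      refine WNLL.sConnected_of_dense hRK hδ hMconn.isPreconnected (M := M) ?_ ?_ ?_
      · rintro _ ⟨i, rfl⟩; exact hPM i
      · exact ⟨S ⟨0, hm⟩ ω, ⟨_, rfl⟩, hSM⟩
      · intro y hy
        obtain ⟨t, ht, hty⟩ := hTcover y hy
        obtain ⟨i, hi⟩ := hhit t ht
        rw [Metric.mem_ball] at hi
        refine ⟨P i ω, ⟨i, rfl⟩, ?_⟩
        linarith [dist_triangle (P i ω) t y]
    exact ⟨hconn, fun μ hμ => WNLL.comparisonPrinciple_of_sConnected hRK hδ hμ hconn⟩
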